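/- Consider a source, a relay and a destination. Time is divided into blocks $i=0,1,2,\dots$ of duration $T>0$. The source–relay and relay–destination channel gains $h_i,g_i$ are constant during block $i$, and all of them are independent circularly symmetric complex Gaussian variables with mean $0$ and variance $1$. Let $P_s,P_r>0$ be the source and relay transmission powers, $0<\eta<1$ the energy conversion efficiency, $d_1,d_2>0$ the source–relay and relay–destination distances, $m\in\mathbb R$ the path loss exponent, $\gamma_0>0$ the SNR threshold, $\sigma_{n_r}^2,\sigma_{n_d}^2>0$ the noise variances at the relay and the destination, and put $$\gamma_{r,i}=\frac{P_s|h_i|^2}{d_1^m\sigma_{n_r}^2},\quad \gamma_{d,i}=\frac{P_r|g_i|^2}{d_2^m\sigma_{n_d}^2},\quad \bar a=\frac{\gamma_0d_1^m\sigma_{n_r}^2}{P_s},\quad \bar b=\frac{\gamma_0d_2^m\sigma_{n_d}^2}{P_r}.$$ In the decode-and-forward relaying protocol with discrete-time energy harvesting (Protocol 4), let $E_i$ be the energy stored at the relay at the start of block $i$, where $E_0\ge 0$ is any (deterministic or random) initial energy independent of all channel gains. If $E_i\ge P_rT/2$ and $\gamma_{r,i}\ge\gamma_0$, then block $i$ is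 used for information transmission: $\alpha_i=0$ and $E_{i+1}=E_i-P_rT/2$. Otherwise the whole block is used for energy harvesting: $\alpha_i=1$ and $E_{i+1}=E_i+\eta P_s|h_i|^2T/d_1^m$. The throughput of block $i$ is $\tau_i=\tfrac12(1-\alpha_i)\,\mathbf 1(\gamma_{d,i}\ge\gamma_0)$. Then the throughput $\tau$ of the protocol exists, i.e. there is a real number $\tau$ such that, as $N\to\infty$, $\frac1N\sum_{i<N}\tau_i\to\tau$ almost surely and $\frac1N\sum_{i<N}\mathbb E[\tau_i]\to\tau$; moreover $\mathbb E[\tau_i]=\tau$ for every $i$ if the stored energy is stationary (i.e. if all $E_i$ have the same law). It satisfies $$\tau\;\ge\;\frac{\eta P_s\,e^{-(\bar a+\bar b)}}{P_r d_1^m e^{-\bar a}+2\eta P_s}.$$ -/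

import Mathlib

open MeasureTheory ProbabilityTheory Filter Topology

/-- The parameters of the two-hop relaying system. `T` is the block time (seconds), `Ps` and `Pr`
the source power and the preset relay power, `eta` the energy conversion efficiency, `d1` and `d2`
the source-relay and relay-destination distances, `m` the path loss exponent, `gamma0` the
threshold SNR, `noiseR` and `noiseD` the noise variances at the relay and at the destination. -/
structure RelaySystem where
  T : ℝ
  Ps : ℝ
  Pr : ℝ
  eta : ℝ
  d1 : ℝ
  d2 : ℝ
  m : ℝ
  gamma0 : ℝ
  noiseR : ℝ
  noiseD : ℝ
  T_pos : 0 < T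
  Ps_pos : 0 < Ps
  Pr_pos : 0 < Pr
  eta_pos : 0 < eta
  eta_lt_one : eta < 1
  d1_pos : 0 < d1
  d2_pos : 0 < d2
  gamma0_pos : 0 < gamma0
  noiseR_pos : 0 < noiseR
  noiseD_pos : 0 < noiseD

/-- The circularly symmetric complex Gaussian law with zero mean and unit variance
(independent real and imaginary parts, each real Gaussian with mean `0` and variance `1/2`). -/
noncomputable def complexGaussian : Measure ℂ :=
  ((gaussianReal 0 (1 / 2)).prod (gaussianReal 0 (1 / 2))).map
    (fun z : ℝ × ℝ => (⟨z.1, z.2⟩ : ℂ))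

namespace RelaySystem

variable (S : RelaySystem)

/-- SNR at the relay when the source-relay gain is `h`. -/
noncomputable def snrRelay (h : ℂ) : ℝ := S.Ps * ‖h‖ ^ 2 / (S.d1 ^ S.m * S.noiseR)

/-- SNR at the destination when the relay-destination gain is `g`. -/
noncomputable def snrDest (g : ℂ) : ℝ := S.Pr * ‖g‖ ^ 2 / (S.d2 ^ S.m * S.noiseD)

/-- The normalized relay outage threshold. -/
noncomputable def aBar : ℝ := S.gamma0 * S.d1 ^ S.m * S.noiseR / S.Ps

/-- The normalized destination outage threshold. -/
noncomputable def bBar : ℝ := S.gamma0 * S.d2 ^ S.m * S.noiseD / S.Pr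

/-- The energy that the relay spends on one information transmission block. -/
noncomputable def txEnergy : ℝ := S.Pr * S.T / 2

/-- The fraction of a block used for energy harvesting, when the block starts with stored energy
`e` and the source-relay gain is `h`: the block is an information transmission block (`0`) if the
stored energy suffices and the relay is not in outage, and a harvesting block (`1`) otherwise. -/
noncomputable def alpha (e : ℝ) (h : ℂ) : ℝ :=
  if S.txEnergy ≤ e ∧ S.gamma0 ≤ S.snrRelay h then 0 else 1

/-- The stored energy at the end of a block that starts with stored energy `e`. -/
noncomputable def energyAfter (e : ℝ) (h : ℂ) : ℝ :=
  if S.alpha e h = 1 then e + S.eta * S.Ps * ‖h‖ ^ 2 / S.d1 ^ S.m * S.T else e - S.txEnergy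

/-- The stored energy at the start of block `i` (blocks are numbered from `0`), for initial stored
energy `e0` and source-relay gains `h 0, h 1, …`. -/
noncomputable def energy (e0 : ℝ) (h : ℕ → ℂ) : ℕ → ℝ
  | 0 => e0
  | i + 1 => S.energyAfter (energy e0 h i) (h i)

/-- The outage indicator at the destination. -/
noncomputable def outage (g : ℂ) : ℝ := if S.snrDest g < S.gamma0 then 1 else 0

/-- The block throughput of block `i`: the fraction of the block time that is used for successful
source-destination transmission. -/
noncomputable def blockThroughput (e0 : ℝ) (h g : ℕ → ℂ) (i : ℕ) : ℝ :=
  (1 - S.outage (g i)) * (1 - S.alpha (S.energy e0 h i) (h i)) / 2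

end RelaySystem

/-- `τ` is the throughput of a system whose random block throughputs are `t 0, t 1, …`: the
time average over the first `N` blocks converges to `τ` almost surely and in expectation. -/
structure IsThroughput {Ω : Type*} [MeasurableSpace Ω] (μ : Measure Ω) (t : ℕ → Ω → ℝ)
    (τ : ℝ) : Prop where
  integrable : ∀ i, Integrable (t i) μ
  tendsto_ae : ∀ᵐ ω ∂μ,
    Tendsto (fun N : ℕ => (∑ i ∈ Finset.range N, t i ω) / (N : ℝ)) atTop (𝓝 τ)
  tendsto_mean :
    Tendsto (fun N : ℕ => (∑ i ∈ Finset.range N, ∫ ω, t i ω ∂μ) / (N : ℝ)) atTop (𝓝 τ)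

/-! The proof is an energy balance along almost every path; it needs no invariant law for the energy
chain. Let `c` be the mean harvest per harvesting block, `w` the transmission energy, and `L` the
mean of `(c‖h‖² + w)` on the event that the relay is not in outage. By `RelaySystem.energyAfter_eq`,
the mean energy change is `c` in a block that starts below `w` and `c - L` otherwise; the remainder
is a centred noise term.

The current gains are independent of the past, so the noise terms are orthogonal with bounded second
moments, and their averages vanish almost surely (`ae_tendsto_average_zero_of_predictable`).
Nonnegativity of the energy then determines the fraction of blocks starting with at least `w`
(`tendsto_fraction_above_level`): it is `min 1 (c / L)`. A charged block succeeds with conditional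
probability `exp (-(aBar + bBar))` and contributes one half, which gives `τ` in closed form. The
mean version follows by dominated convergence. The lower bound comes from `L ≤ c + w * exp (-aBar)`.
-/

/-! ### Law and moments of the squared modulus of a gain. -/

theorem prod_gaussianReal_half_eq_withDensity :
    (gaussianReal 0 (1 / 2)).prod (gaussianReal 0 (1 / 2)) =
      (volume : Measure (ℝ × ℝ)).withDensity
        fun p => ENNReal.ofReal (Real.pi⁻¹ * Real.exp (-(p.1 ^ 2 + p.2 ^ 2))) := by
  have h0 : (1 / 2 : NNReal) ≠ 0 := by norm_num
  rw [gaussianReal_of_var_ne_zero 0 h0, prod_withDensity (measurable_gaussianPDF _ _)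
    (measurable_gaussianPDF _ _)]
  congr 1
  ext p
  rw [gaussianPDF, gaussianPDF, ← ENNReal.ofReal_mul (gaussianPDFReal_nonneg _ _ _)]
  congr 1
  simp only [gaussianPDFReal]
  push_cast
  have h2 : (2 * Real.pi * (1 / 2) : ℝ) = Real.pi := by ring
  rw [h2, mul_mul_mul_comm, ← Real.exp_add, ← mul_inv, Real.mul_self_sqrt Real.pi_pos.le]
  congr 2
  ring

theorem integral_Ioi_mul_exp_neg_sq (s : ℝ) :
    IntegrableOn (fun r : ℝ => r * Real.exp (-r ^ 2)) (Set.Ioi s) ∧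
    ∫ r in Set.Ioi s, r * Real.exp (-r ^ 2) = Real.exp (-s ^ 2) / 2 := by
  have hint : Integrable (fun r : ℝ => r * Real.exp (-r ^ 2)) := by
    simpa using integrable_mul_exp_neg_mul_sq (b := 1) one_pos
  refine ⟨hint.integrableOn, ?_⟩
  have hd : ∀ x ∈ Set.Ici s, HasDerivAt (fun r : ℝ => -(Real.exp (-r ^ 2) / 2))
      (x * Real.exp (-x ^ 2)) x := by
    intro x _
    have := ((((hasDerivAt_id x).pow 2).neg.exp).div_const 2).neg
    convert! this using 1
    simp
    ring
  have ht : Tendsto (fun r : ℝ => -(Real.exp (-r ^ 2) / 2)) atTop (𝓝 0) := by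
    have h1 : Tendsto (fun r : ℝ => -r ^ 2) atTop atBot :=
      tendsto_neg_atTop_atBot.comp (tendsto_pow_atTop two_ne_zero)
    simpa using ((Real.tendsto_exp_atBot.comp h1).div_const 2).neg
  rw [integral_Ioi_of_hasDerivAt_of_tendsto' hd hint.integrableOn ht]
  ring

theorem sq_norm_complexMk (x y : ℝ) : ‖(⟨x, y⟩ : ℂ)‖ ^ 2 = x ^ 2 + y ^ 2 := by
  rw [Complex.sq_norm, Complex.normSq_mk, sq, sq]

theorem measurable_complexMk : Measurable fun z : ℝ × ℝ => (⟨z.1, z.2⟩ : ℂ) :=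
  Complex.measurableEquivRealProd.symm.measurable

instance : IsProbabilityMeasure complexGaussian :=
  Measure.isProbabilityMeasure_map measurable_complexMk.aemeasurable

/-- The squared modulus of a standard complex Gaussian variable is exponentially distributed. -/
theorem complexGaussian_real_le_norm_sq {a : ℝ} (ha : 0 ≤ a) :
    complexGaussian.real {z : ℂ | a ≤ ‖z‖ ^ 2} = Real.exp (-a) := by
  have hset : MeasurableSet {z : ℂ | a ≤ ‖z‖ ^ 2} :=
    measurableSet_le measurable_const (by fun_prop)
  have hpre : (fun z : ℝ × ℝ => (⟨z.1, z.2⟩ : ℂ)) ⁻¹' {z : ℂ | a ≤ ‖z‖ ^ 2}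
      = {p : ℝ × ℝ | a ≤ p.1 ^ 2 + p.2 ^ 2} := by
    ext p
    simp only [Set.mem_preimage, Set.mem_ofPred_eq, sq_norm_complexMk]
  have hset' : MeasurableSet {p : ℝ × ℝ | a ≤ p.1 ^ 2 + p.2 ^ 2} :=
    measurableSet_le measurable_const (by fun_prop)
  have hrad : ∀ p ∈ polarCoord.target, ENNReal.ofReal p.1 •
      ({p : ℝ × ℝ | a ≤ p.1 ^ 2 + p.2 ^ 2}.indicator
        (fun p => ENNReal.ofReal (Real.pi⁻¹ * Real.exp (-(p.1 ^ 2 + p.2 ^ 2))))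
        (polarCoord.symm p))
      = (Set.Ici (√a)).indicator
        (fun r => ENNReal.ofReal (Real.pi⁻¹ * (r * Real.exp (-r ^ 2)))) p.1 := by
    intro p hp
    have hp0 : 0 < p.1 := hp.1
    have hsq : (p.1 * Real.cos p.2) ^ 2 + (p.1 * Real.sin p.2) ^ 2 = p.1 ^ 2 := by
      have := Real.sin_sq_add_cos_sq p.2
      nlinarith
    simp only [polarCoord_symm_apply, Set.indicator_apply, Set.mem_ofPred_eq, hsq, Set.mem_Ici,
      Real.sqrt_le_left hp0.le]
    split_ifs
    · rw [smul_eq_mul, ← ENNReal.ofReal_mul hp0.le]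
      congr 1
      ring
    · simp
  have hI := integral_Ioi_mul_exp_neg_sq (√a)
  have hinter : (Set.Ici (√a) ∩ Set.Ioi 0 : Set ℝ) =ᵐ[volume] Set.Ioi (√a) := by
    have h1 : (Set.Ici (√a) : Set ℝ) =ᵐ[volume] Set.Ioi (√a) := Ioi_ae_eq_Ici.symm
    have h2 := h1.inter (ae_eq_refl (Set.Ioi (0 : ℝ)))
    rwa [Set.inter_eq_left.2 (Set.Ioi_subset_Ioi (Real.sqrt_nonneg a))] at h2
  have hmeasf : Measurable ((Set.Ici (√a)).indicator
      (fun r => ENNReal.ofReal (Real.pi⁻¹ * (r * Real.exp (-r ^ 2))))) :=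
    Measurable.indicator (by fun_prop) measurableSet_Ici
  have key : complexGaussian {z : ℂ | a ≤ ‖z‖ ^ 2} = ENNReal.ofReal (Real.exp (-a)) := by
    rw [complexGaussian, Measure.map_apply measurable_complexMk hset, hpre,
      prod_gaussianReal_half_eq_withDensity, withDensity_apply _ hset', ← lintegral_indicator hset',
      ← lintegral_comp_polarCoord_symm,
      setLIntegral_congr_fun polarCoord.open_target.measurableSet hrad, polarCoord_target,
      Measure.volume_eq_prod, ← Measure.prod_restrict, lintegral_prod _ (by fun_prop)]
    -- The integrand is radial, so the angle contributes the factor `2π`, which cancels the density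
    -- constant `π⁻¹` and the `1/2` from the radial integral.
    simp only [lintegral_const, Measure.restrict_apply_univ]
    rw [lintegral_mul_const _ hmeasf, lintegral_indicator measurableSet_Ici,
      Measure.restrict_restrict measurableSet_Ici, Measure.restrict_congr_set hinter,
      ← ofReal_integral_eq_lintegral_ofReal, integral_const_mul, hI.2, Real.volume_Ioo,
      ← ENNReal.ofReal_mul (by positivity), Real.sq_sqrt ha]
    · congr 1
      field_simp
      ring
    · exact hI.1.const_mul _
    · filter_upwards [ae_restrict_mem measurableSet_Ioi] with r hr
      have : 0 ≤ r := (Real.sqrt_nonneg a).trans (le_of_lt hr)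
      positivity
  rw [measureReal_def, key, ENNReal.toReal_ofReal (Real.exp_pos _).le]

/-- The harvested energy is proportional to `‖z‖ ^ 2`, and the law of large numbers used below
requires second moments of it; these are fourth moments of real Gaussians. -/
theorem memLp_norm_sq_complexGaussian : MemLp (fun z : ℂ => ‖z‖ ^ 2) 2 complexGaussian := by
  rw [complexGaussian, memLp_map_measure_iff (by fun_prop) measurable_complexMk.aemeasurable]
  have h1 : MemLp (fun x : ℝ => x ^ 2) 2 (gaussianReal 0 (1 / 2)) := by
    have h4 : MemLp (id : ℝ → ℝ) 4 (gaussianReal 0 (1 / 2)) := memLp_id_gaussianReal' 4 (by simp)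
    rw [memLp_two_iff_integrable_sq (by fun_prop)]
    refine (h4.integrable_norm_pow (p := 4) (by norm_num)).congr (Eventually.of_forall fun x => ?_)
    simp only [id, Real.norm_eq_abs, ← pow_mul]
    exact Even.pow_abs (by decide) x
  have h2 := (h1.comp_fst (gaussianReal 0 (1 / 2))).add (h1.comp_snd (gaussianReal 0 (1 / 2)))
  refine (memLp_congr_ae (Eventually.of_forall fun p => ?_)).1 h2
  simp only [Pi.add_apply, Function.comp, sq_norm_complexMk]

theorem integral_norm_sq_complexGaussian : ∫ z : ℂ, ‖z‖ ^ 2 ∂complexGaussian = 1 := by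
  rw [complexGaussian, integral_map measurable_complexMk.aemeasurable (by fun_prop)]
  have h0 : ∫ x : ℝ, x ^ 2 ∂(gaussianReal 0 (1 / 2)) = 1 / 2 := by
    have h := variance_fun_id_gaussianReal (μ := 0) (v := 1 / 2)
    rw [variance_of_integral_eq_zero (by fun_prop) integral_id_gaussianReal] at h
    rw [h]
    norm_num
  have hi : Integrable (fun x : ℝ => x ^ 2) (gaussianReal 0 (1 / 2)) :=
    (memLp_id_gaussianReal 2).integrable_sq
  simp only [sq_norm_complexMk]
  rw [integral_add (hi.comp_fst _) (hi.comp_snd _), integral_fun_fst (fun x : ℝ => x ^ 2),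
    integral_fun_snd (fun x : ℝ => x ^ 2), h0]
  simp
  norm_num

/-! ### A strong law for orthogonal variables. -/

section
variable {Ω : Type*} [MeasurableSpace Ω] {μ : Measure Ω}

/-- The sum of the `Y n` has finite integral, hence is finite almost everywhere, and the terms of a
convergent series vanish. -/
theorem ae_tendsto_zero_of_summable_integral {Y : ℕ → Ω → ℝ} (hY : ∀ n ω, 0 ≤ Y n ω)
    (hint : ∀ n, Integrable (Y n) μ) (hsum : Summable fun n => ∫ ω, Y n ω ∂μ) :
    ∀ᵐ ω ∂μ, Tendsto (fun n => Y n ω) atTop (𝓝 0) := by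
  have h := summable_norm_of_tsum_eLpNorm_ne_top (p := 1) le_rfl
    (fun n => (hint n).aestronglyMeasurable) ?_
  · filter_upwards [h] with ω hω
    refine hω.tendsto_atTop_zero.congr fun n => ?_
    rw [Real.norm_of_nonneg (hY n ω)]
  · have h1 : ∀ n, eLpNorm (Y n) 1 μ = ENNReal.ofReal (∫ ω, Y n ω ∂μ) := by
      intro n
      rw [eLpNorm_one_eq_lintegral_enorm, ofReal_integral_eq_lintegral_ofReal (hint n)
        (Eventually.of_forall (hY n))]
      refine lintegral_congr fun ω => ?_
      rw [Real.enorm_eq_ofReal (hY n ω)]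
    simp_rw [h1]
    rw [← ENNReal.ofReal_tsum_of_nonneg (fun n => integral_nonneg (hY n)) hsum]
    exact ENNReal.ofReal_ne_top

theorem integrable_sq_sum_of_memLp_two {ξ : ℕ → Ω → ℝ} (hξ : ∀ i, MemLp (ξ i) 2 μ)
    (s : Finset ℕ) : Integrable (fun ω => (∑ i ∈ s, ξ i ω) ^ 2) μ :=
  (memLp_finsetSum s fun i _ => hξ i).integrable_sq

theorem integral_sq_sum_range_le {ξ : ℕ → Ω → ℝ} {C : ℝ}
    (hξ : ∀ i, MemLp (ξ i) 2 μ) (hC : ∀ i, ∫ ω, ξ i ω ^ 2 ∂μ ≤ C)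
    (horth : ∀ i j, i < j → ∫ ω, ξ i ω * ξ j ω ∂μ = 0) (N : ℕ) :
    ∫ ω, (∑ i ∈ Finset.range N, ξ i ω) ^ 2 ∂μ ≤ N * C := by
  induction N with
  | zero => simp
  | succ N ih =>
    have hmul : ∀ i, Integrable (fun ω => ξ i ω * ξ N ω) μ := fun i =>
      (hξ i).integrable_mul (hξ N)
    have h1 : ∀ ω, (∑ i ∈ Finset.range (N + 1), ξ i ω) ^ 2
        = ((∑ i ∈ Finset.range N, ξ i ω) ^ 2 + 2 * ∑ i ∈ Finset.range N, ξ i ω * ξ N ω)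
          + ξ N ω ^ 2 := by
      intro ω
      rw [Finset.sum_range_succ, ← Finset.sum_mul]
      ring
    have hs : Integrable (fun ω => ∑ i ∈ Finset.range N, ξ i ω * ξ N ω) μ :=
      integrable_finsetSum _ fun i _ => hmul i
    have hsq := integrable_sq_sum_of_memLp_two hξ (Finset.range N)
    simp_rw [h1]
    have hsq2 : Integrable (fun ω => (∑ i ∈ Finset.range N, ξ i ω) ^ 2 +
        2 * ∑ i ∈ Finset.range N, ξ i ω * ξ N ω) μ := hsq.add (hs.const_mul 2)
    rw [integral_add hsq2 (hξ N).integrable_sq,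
      integral_add hsq (hs.const_mul 2), integral_const_mul, integral_finsetSum _ fun i _ => hmul i,
      Finset.sum_eq_zero fun i hi => horth i N (Finset.mem_range.1 hi)]
    push_cast
    linarith [hC N]

/-- The strong law of large numbers for orthogonal random variables with bounded second moments. -/
theorem ae_tendsto_average_zero_of_orthogonal {ξ : ℕ → Ω → ℝ} {C : ℝ}
    (hξ : ∀ i, MemLp (ξ i) 2 μ) (hC : ∀ i, ∫ ω, ξ i ω ^ 2 ∂μ ≤ C)
    (horth : ∀ i j, i < j → ∫ ω, ξ i ω * ξ j ω ∂μ = 0) :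
    ∀ᵐ ω ∂μ, Tendsto (fun N : ℕ => (∑ i ∈ Finset.range N, ξ i ω) / N) atTop (𝓝 0) := by
  have hC0 : 0 ≤ C := (integral_nonneg fun ω => sq_nonneg _).trans (hC 0)
  have hsummable : ∀ K : ℝ, Summable fun n : ℕ => K / ((n : ℝ) + 1) ^ 2 := by
    intro K
    have := (summable_nat_add_iff 1).2 (Real.summable_one_div_nat_pow.2 (by norm_num : 1 < 2))
    simpa [div_eq_mul_inv] using this.mul_left K
  -- `A` controls the averages at the square times `(n + 1) ^ 2`, and `B` the fluctuation up to the
  -- next square. Both have expectation `O(1 / n ^ 2)`: for `A` by orthogonality, for `B` by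
  -- Cauchy–Schwarz, since a gap between squares has only `2 * n + 3` terms.
  set A : ℕ → Ω → ℝ := fun n ω =>
    ((∑ i ∈ Finset.range ((n + 1) ^ 2), ξ i ω) / ((n : ℝ) + 1) ^ 2) ^ 2 with hA
  set B : ℕ → Ω → ℝ := fun n ω =>
    ((∑ i ∈ Finset.Ico ((n + 1) ^ 2) ((n + 2) ^ 2), |ξ i ω|) / ((n : ℝ) + 1) ^ 2) ^ 2 with hB
  have hAint : ∀ n, Integrable (A n) μ := fun n => by
    simp only [hA, div_pow]
    exact (integrable_sq_sum_of_memLp_two hξ _).div_const _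
  have hBint : ∀ n, Integrable (B n) μ := fun n => by
    simp only [hB, div_pow]
    exact (integrable_sq_sum_of_memLp_two (fun i => (hξ i).abs) _).div_const _
  have hAle : ∀ n, ∫ ω, A n ω ∂μ ≤ C / ((n : ℝ) + 1) ^ 2 := by
    intro n
    simp only [hA, div_pow]
    rw [integral_div]
    have := integral_sq_sum_range_le hξ hC horth ((n + 1) ^ 2)
    push_cast at this
    rw [div_le_div_iff₀ (by positivity) (by positivity)]
    calc _ ≤ (((n : ℝ) + 1) ^ 2 * C) * ((n : ℝ) + 1) ^ 2 := by gcongr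
      _ = _ := by ring
  have hBle : ∀ n, ∫ ω, B n ω ∂μ ≤ (9 * C) / ((n : ℝ) + 1) ^ 2 := by
    intro n
    have hcard : (n + 2) ^ 2 - (n + 1) ^ 2 = 2 * n + 3 := by
      have : (n + 2) ^ 2 = 2 * n + 3 + (n + 1) ^ 2 := by ring
      omega
    have h1 : ∫ ω, (∑ i ∈ Finset.Ico ((n + 1) ^ 2) ((n + 2) ^ 2), |ξ i ω|) ^ 2 ∂μ
        ≤ (2 * n + 3) * ((2 * n + 3) * C) := by
      calc _ ≤ ∫ ω, (2 * n + 3 : ℝ) *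
            ∑ i ∈ Finset.Ico ((n + 1) ^ 2) ((n + 2) ^ 2), ξ i ω ^ 2 ∂μ := by
            refine integral_mono (integrable_sq_sum_of_memLp_two (fun i => (hξ i).abs) _)
              ((integrable_finsetSum _ fun i _ => (hξ i).integrable_sq).const_mul _) fun ω => ?_
            have := sq_sum_le_card_mul_sum_sq (s := Finset.Ico ((n + 1) ^ 2) ((n + 2) ^ 2))
              (f := fun i => |ξ i ω|)
            simp only [Nat.card_Ico, hcard, sq_abs] at this
            push_cast at this
            exact this
        _ ≤ _ := by
            rw [integral_const_mul, integral_finsetSum _ fun i _ => (hξ i).integrable_sq]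
            refine mul_le_mul_of_nonneg_left ?_ (by positivity)
            have := Finset.sum_le_card_nsmul (Finset.Ico ((n + 1) ^ 2) ((n + 2) ^ 2))
              (fun i => ∫ ω, ξ i ω ^ 2 ∂μ) C fun i _ => hC i
            simp only [Nat.card_Ico, hcard, nsmul_eq_mul] at this
            push_cast at this
            exact this
    simp only [hB, div_pow]
    rw [integral_div, div_le_div_iff₀ (by positivity) (by positivity)]
    have h3 : (2 * (n : ℝ) + 3) * ((2 * n + 3) * C) ≤ 9 * C * ((n : ℝ) + 1) ^ 2 := by
      have : 0 ≤ (n : ℝ) := n.cast_nonneg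
      have : (2 * (n : ℝ) + 3) * (2 * n + 3) ≤ 9 * ((n : ℝ) + 1) ^ 2 := by nlinarith
      nlinarith
    calc _ ≤ (9 * C * ((n : ℝ) + 1) ^ 2) * ((n : ℝ) + 1) ^ 2 := by gcongr; linarith
      _ = _ := by ring
  have hAt := ae_tendsto_zero_of_summable_integral (fun n ω => sq_nonneg _) hAint
    (Summable.of_nonneg_of_le (fun n => integral_nonneg fun ω => sq_nonneg _) hAle (hsummable _))
  have hBt := ae_tendsto_zero_of_summable_integral (fun n ω => sq_nonneg _) hBint
    (Summable.of_nonneg_of_le (fun n => integral_nonneg fun ω => sq_nonneg _) hBle (hsummable _))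
  filter_upwards [hAt, hBt] with ω h1 h2
  have hsqrt := ((Real.continuous_sqrt.tendsto 0).comp h1).add
    ((Real.continuous_sqrt.tendsto 0).comp h2)
  simp only [Real.sqrt_zero, add_zero] at hsqrt
  -- A general `N` lies between the squares of `n + 1` and `n + 2` with `n = Nat.sqrt N - 1`.
  have hroot : Tendsto (fun N : ℕ => Nat.sqrt N - 1) atTop atTop := by
    refine (tendsto_sub_atTop_nat 1).comp (tendsto_atTop.2 fun b => ?_)
    filter_upwards [eventually_ge_atTop (b * b)] with n hn
    exact Nat.le_sqrt.2 hn
  refine squeeze_zero_norm' ?_ (hsqrt.comp hroot)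
  filter_upwards [eventually_ge_atTop 1] with N hN
  obtain ⟨n, hn⟩ : ∃ n, Nat.sqrt N = n + 1 :=
    ⟨Nat.sqrt N - 1, by have := Nat.sqrt_pos.2 hN; omega⟩
  have hle : (n + 1) ^ 2 ≤ N := by rw [← hn]; exact Nat.sqrt_le' N
  have hlt : N < (n + 2) ^ 2 := by have := Nat.lt_succ_sqrt' N; rwa [hn] at this
  simp only [Function.comp, hn, Nat.add_sub_cancel]
  rw [Real.sqrt_sq_eq_abs, Real.sqrt_sq_eq_abs, ← Finset.sum_range_add_sum_Ico _ hle, norm_div,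
    Real.norm_eq_abs, Real.norm_natCast, abs_div, abs_div, abs_of_pos (by positivity :
    (0 : ℝ) < ((n : ℝ) + 1) ^ 2), ← add_div]
  refine div_le_div₀ (by positivity) ?_ (by positivity) (by exact_mod_cast hle)
  refine (abs_add_le _ _).trans (add_le_add le_rfl ?_)
  refine (Finset.abs_sum_le_sum_abs _ _).trans (le_trans ?_ (le_abs_self _))
  exact Finset.sum_le_sum_of_subset_of_nonneg (Finset.Ico_subset_Ico le_rfl hlt.le)
    fun _ _ _ => abs_nonneg _

end

/-! ### Time above a level for a sequence with two drifts. -/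

theorem tendsto_zero_of_forall_le_add_mul {u : ℕ → ℝ} (hu : ∀ n, 0 ≤ u n)
    (h : ∀ ε > 0, ∃ K : ℝ, ∀ n, u n ≤ K + ε * n) :
    Tendsto (fun n : ℕ => u n / n) atTop (𝓝 0) := by
  rw [Metric.tendsto_atTop]
  intro ε hε
  obtain ⟨K, hK⟩ := h (ε / 2) (half_pos hε)
  obtain ⟨N, hN⟩ := exists_nat_gt (2 * K / ε)
  refine ⟨max N 1, fun n hn => ?_⟩
  have hn1 : (1 : ℝ) ≤ n := by exact_mod_cast (le_max_right N 1).trans hn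
  have hnN : (N : ℝ) ≤ n := by exact_mod_cast (le_max_left N 1).trans hn
  have hpos : (0 : ℝ) < n := by linarith
  have hKn : 2 * K < n * ε := by
    rw [← div_lt_iff₀ hε]
    linarith
  rw [Real.dist_eq, sub_zero, abs_of_nonneg (div_nonneg (hu n) hpos.le), div_lt_iff₀ hpos]
  have := hK n
  linarith

/-- The constant absorbs the finitely many early terms, so sublinear growth becomes a bound valid
for every `n`, as the inductions below require. -/
theorem exists_abs_le_add_mul_of_tendsto {M : ℕ → ℝ}
    (hM : Tendsto (fun n : ℕ => M n / n) atTop (𝓝 0)) {ε : ℝ} (hε : 0 < ε) :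
    ∃ K : ℝ, ∀ n, |M n| ≤ K + ε * n := by
  obtain ⟨N, hN⟩ := Metric.tendsto_atTop.1 hM ε hε
  refine ⟨∑ i ∈ Finset.range (N + 1), |M i|, fun n => ?_⟩
  rcases lt_or_ge n (N + 1) with hn | hn
  · have := Finset.single_le_sum (f := fun i => |M i|) (fun i _ => abs_nonneg _)
      (Finset.mem_range.2 hn)
    have h0 : 0 ≤ ε * (n : ℝ) := by positivity
    linarith
  · have hpos : (0 : ℝ) < n := by exact_mod_cast (by omega : 0 < n)
    have := hN n (by omega)
    rw [Real.dist_eq, sub_zero, abs_div, abs_of_pos hpos, div_lt_iff₀ hpos] at this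
    have h0 : 0 ≤ ∑ i ∈ Finset.range (N + 1), |M i| := Finset.sum_nonneg fun i _ => abs_nonneg _
    linarith

/-- A nonnegative process that drifts by `c > 0` below the level `w` and by `D < c` above it, up to
a perturbation of sublinear size, spends the fraction `min 1 (c / (c - D))` of the time above
`w`. -/
theorem tendsto_fraction_above_level {E M : ℕ → ℝ} {w c D : ℝ} (hE : ∀ n, 0 ≤ E n)
    (hM : Tendsto (fun n : ℕ => M n / n) atTop (𝓝 0)) (hc : 0 < c) (hD : D < c)
    (hrec : ∀ n, E (n + 1) = E n + (M (n + 1) - M n) + if w ≤ E n then D else c) :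
    Tendsto (fun N : ℕ => (∑ i ∈ Finset.range N, if w ≤ E i then (1 : ℝ) else 0) / N) atTop
      (𝓝 (min 1 (c / (c - D)))) := by
  have hcD : 0 < c - D := sub_pos.2 hD
  set S : ℕ → ℝ := fun N => ∑ i ∈ Finset.range N, if w ≤ E i then (1 : ℝ) else 0 with hS
  -- Summed energy balance: the limit of `S N / N` can be read off once that of `E N / N` is known.
  have key : ∀ N : ℕ, E N = E 0 + (M N - M 0) + c * N - (c - D) * S N := by
    intro N
    induction N with
    | zero => simp [hS]
    | succ N ih =>
      have h1 : S (N + 1) = S N + if w ≤ E N then (1 : ℝ) else 0 := by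
        simp only [hS, Finset.sum_range_succ]
      rw [hrec, h1]
      push_cast
      split_ifs <;> linarith
  have hconst : ∀ a : ℝ, Tendsto (fun n : ℕ => a / n) atTop (𝓝 0) := fun a =>
    tendsto_const_div_atTop_nhds_zero_nat a
  rcases le_or_gt D 0 with hD0 | hD0
  · have hEN : Tendsto (fun n : ℕ => E n / n) atTop (𝓝 0) := by
      refine tendsto_zero_of_forall_le_add_mul hE fun ε hε => ?_
      obtain ⟨K, hK⟩ := exists_abs_le_add_mul_of_tendsto hM (half_pos hε)
      have hK0 : 0 ≤ K := by simpa using (abs_nonneg _).trans (hK 0)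
      -- Removing `M` leaves only the drift. Above `w` the step `D ≤ 0` preserves the bound; below
      -- `w` the value after the step is less than `w + c - M n`, so the bound holds afresh whatever
      -- came before.
      have hbound : ∀ n : ℕ, E n - M n ≤ E 0 + |M 0| + |w| + c + K + ε / 2 * n := by
        intro n
        induction n with
        | zero =>
          have := neg_abs_le (M 0)
          have := abs_nonneg w
          push_cast
          linarith
        | succ n ih =>
          rw [hrec]
          push_cast
          split_ifs with h
          · linarith
          · have h1 := (abs_le.1 (hK n)).1
            have h2 := le_abs_self w
            have h3 := abs_nonneg (M 0)
            have h4 := hE 0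
            linarith
      refine ⟨E 0 + |M 0| + |w| + c + K + K, fun n => ?_⟩
      have := hbound n
      have := (abs_le.1 (hK n)).2
      linarith
    rw [min_eq_right ((div_le_one hcD).2 (by linarith))]
    have h1 : Tendsto (fun n : ℕ => ((E 0 - M 0) / n + M n / n + c - E n / n) / (c - D)) atTop
        (𝓝 ((0 + 0 + c - 0) / (c - D))) :=
      ((((hconst _).add hM).add_const c).sub hEN).div_const _
    simp only [zero_add, sub_zero] at h1
    refine h1.congr' ?_
    filter_upwards [eventually_gt_atTop 0] with n hn
    have hn' : (n : ℝ) ≠ 0 := by exact_mod_cast hn.ne'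
    have := key n
    rw [div_eq_div_iff hcD.ne' hn']
    field_simp
    linarith
  · rw [min_eq_left ((one_le_div hcD).2 (by linarith))]
    -- Each drift is at least `D > 0`, so `E` grows at least like `D * n / 2` and eventually stays
    -- above the level.
    have hev : ∀ᶠ n : ℕ in atTop, w ≤ E n := by
      obtain ⟨K, hK⟩ := exists_abs_le_add_mul_of_tendsto hM (half_pos hD0)
      obtain ⟨N, hN⟩ := exists_nat_gt ((w + K + |M 0|) / (D / 2))
      filter_upwards [eventually_ge_atTop N] with n hn
      have hSn : S n ≤ n := by
        calc S n ≤ ∑ i ∈ Finset.range n, (1 : ℝ) :=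
              Finset.sum_le_sum fun i _ => by split_ifs <;> norm_num
          _ = n := by simp
      have h1 := (abs_le.1 (hK n)).1
      have h2 := le_abs_self (M 0)
      have h3 := hE 0
      have h4 : (N : ℝ) ≤ n := by exact_mod_cast hn
      rw [div_lt_iff₀ (half_pos hD0)] at hN
      have h5 : (c - D) * S n ≤ (c - D) * n := mul_le_mul_of_nonneg_left hSn hcD.le
      have h6 : (N : ℝ) * (D / 2) ≤ n * (D / 2) := mul_le_mul_of_nonneg_right h4 (by linarith)
      rw [key n]
      linarith
    have h1 : Tendsto (fun n => if w ≤ E n then (1 : ℝ) else 0) atTop (𝓝 1) := by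
      refine tendsto_const_nhds.congr' ?_
      filter_upwards [hev] with n hn
      simp [hn]
    refine h1.cesaro.congr fun n => ?_
    rw [div_eq_inv_mul]

/-! ### Independence of past and present, and predictable weights. -/

/-- The initial value together with the terms of `Z` before time `j`. -/
def pastOf {Ω α γ : Type*} [Zero γ] (X : Ω → α) (Z : ℕ → Ω → γ) (j : ℕ) (ω : Ω) : α × (ℕ → γ) :=
  (X ω, fun k => if k < j then Z k ω else 0)

/-- This is the filtration property, with measurability expressed by an explicit map: a later past
determines every earlier past and the variable that followed it. -/
theorem exists_pastOf_eq {Ω α γ : Type*} [Zero γ] [MeasurableSpace α] [MeasurableSpace γ]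
    (X : Ω → α) (Z : ℕ → Ω → γ) {i j : ℕ} (hij : i < j) :
    ∃ ψ : α × (ℕ → γ) → (α × (ℕ → γ)) × γ, Measurable ψ ∧
      ∀ ω, (pastOf X Z i ω, Z i ω) = ψ (pastOf X Z j ω) := by
  refine ⟨fun b => ((b.1, fun k => if k < i then b.2 k else 0), b.2 i), ?_, fun ω => ?_⟩
  · refine (measurable_fst.prodMk (measurable_pi_iff.2 fun k => ?_)).prodMk
      ((measurable_pi_apply i).comp measurable_snd)
    by_cases hk : k < i
    · simp only [hk, if_true]
      exact (measurable_pi_apply k).comp measurable_snd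
    · simp [hk]
  · simp only [pastOf, hij, if_true, Prod.mk.injEq, true_and, and_true]
    funext k
    split_ifs with h1 h2
    · rfl
    · exact absurd (h1.trans hij) h2
    · rfl

section
variable {Ω : Type*} [MeasurableSpace Ω] {μ : Measure Ω}

theorem ProbabilityTheory.IndepFun.prodMk_left_of_prodMk_right [IsProbabilityMeasure μ]
    {α β γ : Type*} [MeasurableSpace α] [MeasurableSpace β] [MeasurableSpace γ]
    {X : Ω → α} {Y : Ω → β} {Z : Ω → γ} (hX : Measurable X) (hY : Measurable Y) (hZ : Measurable Z)
    (h : IndepFun X (fun ω => (Y ω, Z ω)) μ) (hYZ : IndepFun Y Z μ) :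
    IndepFun (fun ω => (X ω, Y ω)) Z μ := by
  have := Measure.isProbabilityMeasure_map (μ := μ) hX.aemeasurable
  have := Measure.isProbabilityMeasure_map (μ := μ) hY.aemeasurable
  have := Measure.isProbabilityMeasure_map (μ := μ) hZ.aemeasurable
  have hXY : IndepFun X Y μ := h.comp measurable_id measurable_fst
  have h1 := (indepFun_iff_map_prod_eq_prod_map_map hX.aemeasurable
    (hY.prodMk hZ).aemeasurable).1 h
  rw [(indepFun_iff_map_prod_eq_prod_map_map hY.aemeasurable hZ.aemeasurable).1 hYZ] at h1
  rw [indepFun_iff_map_prod_eq_prod_map_map (hX.prodMk hY).aemeasurable hZ.aemeasurable,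
    (indepFun_iff_map_prod_eq_prod_map_map hX.aemeasurable hY.aemeasurable).1 hXY]
  have h2 := congrArg (Measure.map MeasurableEquiv.prodAssoc.symm) h1
  rw [Measure.map_map (MeasurableEquiv.measurable _) (hX.prodMk (hY.prodMk hZ)),
    ← Measure.prodAssoc_prod, Measure.map_map (MeasurableEquiv.measurable _)
    (MeasurableEquiv.measurable _), MeasurableEquiv.symm_comp_self, Measure.map_id] at h2
  exact h2

/-- A strong law of large numbers for predictably weighted identically distributed variables:
`past j` carries the information before time `j`, and `Z j` is independent of it. -/
theorem ae_tendsto_average_zero_of_predictable [IsProbabilityMeasure μ]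
    {β γ : Type*} [MeasurableSpace β] [MeasurableSpace γ] {past : ℕ → Ω → β} {Z : ℕ → Ω → γ}
    {ν : Measure γ} (hpast : ∀ j, Measurable (past j)) (hZ : ∀ j, Measurable (Z j))
    (hlaw : ∀ j, μ.map (Z j) = ν) (hindep : ∀ j, IndepFun (past j) (Z j) μ)
    (hadapt : ∀ i j, i < j → ∃ ψ : β → β × γ, Measurable ψ ∧
      ∀ ω, (past i ω, Z i ω) = ψ (past j ω))
    {H : ℕ → β → ℝ} (hH : ∀ j, Measurable (H j)) (hH1 : ∀ j b, |H j b| ≤ 1)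
    {f : γ → ℝ} (hfm : Measurable f) (hf : MemLp f 2 ν) (hf0 : ∫ z, f z ∂ν = 0) :
    ∀ᵐ ω ∂μ, Tendsto (fun N : ℕ =>
      (∑ i ∈ Finset.range N, H i (past i ω) * f (Z i ω)) / N) atTop (𝓝 0) := by
  have hfZ : ∀ j, MemLp (fun ω => f (Z j ω)) 2 μ := fun j => by
    rw [← hlaw j, memLp_map_measure_iff hfm.aestronglyMeasurable (hZ j).aemeasurable] at hf
    exact hf
  have hmeas : ∀ j, Measurable fun ω => H j (past j ω) * f (Z j ω) := fun j =>
    ((hH j).comp (hpast j)).mul (hfm.comp (hZ j))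
  have hle : ∀ j ω, |H j (past j ω) * f (Z j ω)| ≤ |f (Z j ω)| := fun j ω => by
    rw [abs_mul]
    exact mul_le_of_le_one_left (abs_nonneg _) (hH1 _ _)
  have hξ : ∀ j, MemLp (fun ω => H j (past j ω) * f (Z j ω)) 2 μ := fun j =>
    (hfZ j).mono (hmeas j).aestronglyMeasurable (Eventually.of_forall fun ω => hle j ω)
  refine ae_tendsto_average_zero_of_orthogonal (C := ∫ z, f z ^ 2 ∂ν) hξ (fun j => ?_)
    fun i j hij => ?_
  · rw [← hlaw j, integral_map (hZ j).aemeasurable (hfm.pow_const 2).aestronglyMeasurable]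
    exact integral_mono (hξ j).integrable_sq (hfZ j).integrable_sq fun ω => sq_le_sq.2 (hle j ω)
  · obtain ⟨ψ, hψ, hψω⟩ := hadapt i j hij
    -- Everything except `f (Z j ω)` is a function of the past at `j`; independence and the zero
    -- mean of `f` then give orthogonality.
    have h1 : ∀ ω, H i (past i ω) * f (Z i ω) * (H j (past j ω) * f (Z j ω))
        = (H i (ψ (past j ω)).1 * f (ψ (past j ω)).2 * H j (past j ω)) * f (Z j ω) := by
      intro ω
      rw [← hψω ω]
      ring
    simp_rw [h1]
    have hm : Measurable fun b => H i (ψ b).1 * f (ψ b).2 * H j b :=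
      (((hH i).comp hψ.fst).mul (hfm.comp hψ.snd)).mul (hH j)
    have h2 := ((hindep j).comp hm hfm).integral_fun_mul_eq_mul_integral
      (hm.comp (hpast j)).aestronglyMeasurable (hfm.comp (hZ j)).aestronglyMeasurable
    simp only [Function.comp] at h2
    rw [h2, ← integral_map (hZ j).aemeasurable hfm.aestronglyMeasurable, hlaw j, hf0, mul_zero]

theorem measurable_pastOf {α γ : Type*} [Zero γ] [MeasurableSpace α] [MeasurableSpace γ]
    {X : Ω → α} {Z : ℕ → Ω → γ} (hX : Measurable X) (hZ : ∀ j, Measurable (Z j)) (j : ℕ) :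
    Measurable (pastOf X Z j) := by
  refine hX.prodMk (measurable_pi_iff.2 fun k => ?_)
  by_cases hk : k < j
  · simpa [hk] using hZ k
  · simp [hk]

/-- Two independences are glued: `E₀` from all gains jointly, and the gains before `j` from those at
`j`, which occupy disjoint index sets of one independent family. -/
theorem indepFun_pastOf_prodMk [IsProbabilityMeasure μ] {h g : ℕ → Ω → ℂ} {E₀ : Ω → ℝ}
    (h_meas : ∀ i, Measurable (h i)) (g_meas : ∀ i, Measurable (g i)) (E₀_meas : Measurable E₀)
    (hg_indep : iIndepFun (fun k : ℕ ⊕ ℕ => Sum.elim h g k) μ)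
    (E₀_indep : IndepFun E₀ (fun ω => ((fun i => h i ω), (fun i => g i ω))) μ) (j : ℕ) :
    IndepFun (pastOf E₀ (fun i ω => (h i ω, g i ω)) j) (fun ω => (h j ω, g j ω)) μ := by
  have hm : ∀ k : ℕ ⊕ ℕ, Measurable (Sum.elim h g k) := by
    rintro (k | k)
    exacts [h_meas k, g_meas k]
  have hZ : ∀ k, Measurable fun ω => (h k ω, g k ω) := fun k => (h_meas k).prodMk (g_meas k)
  have hYm : Measurable fun ω => (pastOf E₀ (fun i ω => (h i ω, g i ω)) j ω).2 :=
    (measurable_pastOf E₀_meas hZ j).snd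
  refine IndepFun.prodMk_left_of_prodMk_right E₀_meas hYm (hZ j) ?_ ?_
  · refine E₀_indep.comp (φ := id)
      (ψ := fun p : (ℕ → ℂ) × (ℕ → ℂ) =>
        ((fun k => if k < j then (p.1 k, p.2 k) else 0), (p.1 j, p.2 j))) measurable_id ?_
    refine (measurable_pi_iff.2 fun k => ?_).prodMk (by fun_prop)
    by_cases hk : k < j
    · simp only [hk, if_true]
      fun_prop
    · simp [hk]
  · have hdisj : Disjoint ((Finset.range j).disjSum (Finset.range j))
        (({j} : Finset ℕ).disjSum ({j} : Finset ℕ)) := by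
      rw [Finset.disjoint_left]
      rintro (k | k) hk hk' <;> simp at hk hk' <;> omega
    have h1 := hg_indep.indepFun_finset _ _ hdisj hm
    have hφ : Measurable fun (y : (Finset.range j).disjSum (Finset.range j) → ℂ) (k : ℕ) =>
        if hk : k < j then
          (y ⟨Sum.inl k, by simpa using hk⟩, y ⟨Sum.inr k, by simpa using hk⟩) else 0 := by
      refine measurable_pi_iff.2 fun k => ?_
      by_cases hk : k < j
      · simp only [hk, dif_pos]
        fun_prop
      · simp [hk]
    have hψ : Measurable fun y : ({j} : Finset ℕ).disjSum ({j} : Finset ℕ) → ℂ =>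
        (y ⟨Sum.inl j, by simp⟩, y ⟨Sum.inr j, by simp⟩) := by
      fun_prop
    exact h1.comp hφ hψ

end

/-! ### Energy recursion and constants of the protocol. -/

namespace RelaySystem

variable (S : RelaySystem)

/-- The indicator that the relay is not in outage. -/
noncomputable def relaySuccess (z : ℂ) : ℝ := if S.gamma0 ≤ S.snrRelay z then 1 else 0

/-- The indicator that the stored energy suffices for a transmission block. -/
noncomputable def charged (e : ℝ) : ℝ := if S.txEnergy ≤ e then 1 else 0

/-- The mean energy harvested in a harvesting block. -/
noncomputable def harvestRate : ℝ := S.eta * S.Ps * S.T / S.d1 ^ S.m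

/-- The mean loss, relative to harvesting, in a block that starts with sufficient energy. -/
noncomputable def chargedLoss : ℝ :=
  ∫ z, (S.harvestRate * ‖z‖ ^ 2 + S.txEnergy) * S.relaySuccess z ∂complexGaussian

theorem txEnergy_pos : 0 < S.txEnergy := half_pos (mul_pos S.Pr_pos S.T_pos)

theorem harvestRate_pos : 0 < S.harvestRate :=
  div_pos (mul_pos (mul_pos S.eta_pos S.Ps_pos) S.T_pos) (Real.rpow_pos_of_pos S.d1_pos _)

theorem le_snrRelay_iff (z : ℂ) : S.gamma0 ≤ S.snrRelay z ↔ S.aBar ≤ ‖z‖ ^ 2 := by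
  have := S.Ps_pos
  have := S.noiseR_pos
  have := Real.rpow_pos_of_pos S.d1_pos S.m
  rw [snrRelay, aBar, le_div_iff₀ (by positivity), div_le_iff₀ (by positivity), mul_assoc,
    mul_comm S.Ps]

theorem le_snrDest_iff (z : ℂ) : S.gamma0 ≤ S.snrDest z ↔ S.bBar ≤ ‖z‖ ^ 2 := by
  have := S.Pr_pos
  have := S.noiseD_pos
  have := Real.rpow_pos_of_pos S.d2_pos S.m
  rw [snrDest, bBar, le_div_iff₀ (by positivity), div_le_iff₀ (by positivity), mul_assoc,
    mul_comm S.Pr]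

theorem aBar_nonneg : 0 ≤ S.aBar := by
  have := S.Ps_pos
  have := S.noiseR_pos
  have := S.gamma0_pos
  have := Real.rpow_pos_of_pos S.d1_pos S.m
  unfold aBar
  positivity

theorem bBar_nonneg : 0 ≤ S.bBar := by
  have := S.Pr_pos
  have := S.noiseD_pos
  have := S.gamma0_pos
  have := Real.rpow_pos_of_pos S.d2_pos S.m
  unfold bBar
  positivity

theorem relaySuccess_eq_indicator :
    S.relaySuccess = {z : ℂ | S.aBar ≤ ‖z‖ ^ 2}.indicator fun _ => 1 := by
  funext z
  simp only [relaySuccess, le_snrRelay_iff, Set.indicator_apply, Set.mem_ofPred_eq]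

theorem one_sub_outage_eq_indicator :
    (fun z => 1 - S.outage z) = {z : ℂ | S.bBar ≤ ‖z‖ ^ 2}.indicator fun _ => 1 := by
  funext z
  simp only [outage, ← not_le, le_snrDest_iff, Set.indicator_apply, Set.mem_ofPred_eq]
  split_ifs <;> norm_num

theorem measurableSet_le_norm_sq (a : ℝ) : MeasurableSet {z : ℂ | a ≤ ‖z‖ ^ 2} :=
  measurableSet_le measurable_const (by fun_prop)

theorem measurable_relaySuccess : Measurable S.relaySuccess := by
  rw [relaySuccess_eq_indicator]
  exact measurable_const.indicator (measurableSet_le_norm_sq _)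

theorem measurable_outage : Measurable S.outage := by
  have h : Measurable fun z => 1 - S.outage z := by
    rw [one_sub_outage_eq_indicator]
    exact measurable_const.indicator (measurableSet_le_norm_sq _)
  have h' : Measurable fun z => 1 - (1 - S.outage z) := measurable_const.sub h
  simpa using h'

theorem measurable_charged : Measurable S.charged :=
  Measurable.ite measurableSet_Ici measurable_const measurable_const

theorem relaySuccess_mem_Icc (z : ℂ) : S.relaySuccess z ∈ Set.Icc (0 : ℝ) 1 := by
  unfold relaySuccess
  split_ifs <;> simp

theorem one_sub_outage_mem_Icc (z : ℂ) : 1 - S.outage z ∈ Set.Icc (0 : ℝ) 1 := by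
  unfold outage
  split_ifs <;> simp

theorem charged_mem_Icc (e : ℝ) : S.charged e ∈ Set.Icc (0 : ℝ) 1 := by
  unfold charged
  split_ifs <;> simp

theorem integral_relaySuccess :
    ∫ z, S.relaySuccess z ∂complexGaussian = Real.exp (-S.aBar) := by
  rw [relaySuccess_eq_indicator, integral_indicator_const _ (measurableSet_le_norm_sq _),
    complexGaussian_real_le_norm_sq S.aBar_nonneg, smul_eq_mul, mul_one]

theorem integral_one_sub_outage :
    ∫ z, (1 - S.outage z) ∂complexGaussian = Real.exp (-S.bBar) := by
  rw [one_sub_outage_eq_indicator, integral_indicator_const _ (measurableSet_le_norm_sq _),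
    complexGaussian_real_le_norm_sq S.bBar_nonneg, smul_eq_mul, mul_one]

theorem one_sub_alpha (e : ℝ) (z : ℂ) : 1 - S.alpha e z = S.charged e * S.relaySuccess z := by
  unfold alpha charged relaySuccess
  split_ifs with h1 h2 h3 h2 h3 <;> simp_all

/-- Doob-type decomposition of one step: the bracket has zero mean when `z` is a fresh gain, and the
last term is the drift determined by the current energy. The energy enters the noise only through
the bounded weight `charged`, so no moments of the energy are needed. -/
theorem energyAfter_eq (e : ℝ) (z : ℂ) :
    S.energyAfter e z = e + (S.harvestRate * (‖z‖ ^ 2 - 1) -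
      S.charged e * ((S.harvestRate * ‖z‖ ^ 2 + S.txEnergy) * S.relaySuccess z - S.chargedLoss)) +
      if S.txEnergy ≤ e then S.harvestRate - S.chargedLoss else S.harvestRate := by
  have h : S.eta * S.Ps * ‖z‖ ^ 2 / S.d1 ^ S.m * S.T = S.harvestRate * ‖z‖ ^ 2 := by
    unfold harvestRate
    ring
  unfold energyAfter alpha charged relaySuccess
  rw [h]
  by_cases h1 : S.txEnergy ≤ e <;> by_cases h2 : S.gamma0 ≤ S.snrRelay z <;> simp [h1, h2] <;> ring

theorem energyAfter_nonneg {e : ℝ} (he : 0 ≤ e) (z : ℂ) : 0 ≤ S.energyAfter e z := by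
  have := S.Ps_pos
  have := S.eta_pos
  have := S.T_pos
  have := Real.rpow_pos_of_pos S.d1_pos S.m
  unfold energyAfter alpha
  split_ifs with h1 h2 h2
  · simp at h2
  · linarith [h1.1]
  · positivity
  · simp at h2

theorem energy_nonneg {e : ℝ} (he : 0 ≤ e) (h : ℕ → ℂ) : ∀ i, 0 ≤ S.energy e h i
  | 0 => he
  | i + 1 => S.energyAfter_nonneg (energy_nonneg he h i) _

/-- Predictability: setting the gains from block `i` onward to zero, as `pastOf` does, leaves the
energy at the start of block `i` unchanged. -/
theorem energy_congr (e : ℝ) {h h' : ℕ → ℂ} :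
    ∀ i, (∀ k < i, h k = h' k) → S.energy e h i = S.energy e h' i
  | 0, _ => rfl
  | i + 1, H => by
    rw [energy, energy, energy_congr e i fun k hk => H k (hk.trans i.lt_succ_self),
      H i i.lt_succ_self]

theorem measurable_energyAfter : Measurable fun p : ℝ × ℂ => S.energyAfter p.1 p.2 := by
  simp_rw [energyAfter_eq]
  have := S.measurable_charged
  have := S.measurable_relaySuccess
  refine Measurable.add (by fun_prop) ?_
  exact Measurable.ite (measurableSet_le measurable_const measurable_fst) measurable_const
    measurable_const

theorem measurable_energy (i : ℕ) : Measurable fun p : ℝ × (ℕ → ℂ) => S.energy p.1 p.2 i := by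
  induction i with
  | zero => exact measurable_fst
  | succ i ih =>
    exact S.measurable_energyAfter.comp (ih.prodMk ((measurable_pi_apply i).comp measurable_snd))

theorem memLp_two_of_mem_Icc {α : Type*} [MeasurableSpace α] {ν : Measure α} [IsFiniteMeasure ν]
    {f : α → ℝ} (hf : Measurable f) (h : ∀ z, f z ∈ Set.Icc (0 : ℝ) 1) : MemLp f 2 ν :=
  MemLp.of_bound hf.aestronglyMeasurable 1 (Eventually.of_forall fun z => by
    rw [Real.norm_of_nonneg (h z).1]
    exact (h z).2)

theorem memLp_loss :
    MemLp (fun z => (S.harvestRate * ‖z‖ ^ 2 + S.txEnergy) * S.relaySuccess z) 2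
      complexGaussian := by
  have h1 : MemLp (fun z : ℂ => S.harvestRate * ‖z‖ ^ 2 + S.txEnergy) 2 complexGaussian :=
    (memLp_norm_sq_complexGaussian.const_mul _).add (memLp_const _)
  refine h1.mono ?_ (Eventually.of_forall fun z => ?_)
  · exact (Measurable.mul (by fun_prop) S.measurable_relaySuccess).aestronglyMeasurable
  · rw [norm_mul, Real.norm_of_nonneg (S.relaySuccess_mem_Icc z).1]
    exact mul_le_of_le_one_right (norm_nonneg _) (S.relaySuccess_mem_Icc z).2

theorem integrable_relaySuccess : Integrable S.relaySuccess complexGaussian :=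
  (memLp_two_of_mem_Icc S.measurable_relaySuccess S.relaySuccess_mem_Icc).integrable one_le_two

theorem integrable_norm_sq : Integrable (fun z : ℂ => ‖z‖ ^ 2) complexGaussian :=
  memLp_norm_sq_complexGaussian.integrable one_le_two

theorem chargedLoss_pos : 0 < S.chargedLoss := by
  have h : ∫ z, S.txEnergy * S.relaySuccess z ∂complexGaussian ≤ S.chargedLoss := by
    refine integral_mono (S.integrable_relaySuccess.const_mul _)
      (S.memLp_loss.integrable one_le_two) fun z => ?_
    refine mul_le_mul_of_nonneg_right ?_ (S.relaySuccess_mem_Icc z).1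
    have := mul_nonneg S.harvestRate_pos.le (sq_nonneg ‖z‖)
    linarith
  rw [integral_const_mul, integral_relaySuccess] at h
  exact (mul_pos S.txEnergy_pos (Real.exp_pos _)).trans_le h

/-- The outage indicator is bounded by `1` in the harvesting term only, where the mean of `‖z‖ ^ 2`
is `1`. This is the one place where the exact throughput is traded for the simpler bound. -/
theorem chargedLoss_le : S.chargedLoss ≤ S.harvestRate + S.txEnergy * Real.exp (-S.aBar) := by
  have h1 : Integrable (fun z : ℂ => S.harvestRate * ‖z‖ ^ 2) complexGaussian :=
    integrable_norm_sq.const_mul _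
  have h2 : Integrable (fun z : ℂ => S.txEnergy * S.relaySuccess z) complexGaussian :=
    S.integrable_relaySuccess.const_mul _
  calc S.chargedLoss
      ≤ ∫ z, (S.harvestRate * ‖z‖ ^ 2 + S.txEnergy * S.relaySuccess z) ∂complexGaussian := by
        refine integral_mono (S.memLp_loss.integrable one_le_two) (h1.add h2) fun z => ?_
        have := mul_le_mul_of_nonneg_left (S.relaySuccess_mem_Icc z).2
          (mul_nonneg S.harvestRate_pos.le (sq_nonneg ‖z‖))
        simp only
        linarith
    _ = _ := by
        rw [integral_add h1 h2, integral_const_mul, integral_const_mul, integral_relaySuccess,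
          integral_norm_sq_complexGaussian, mul_one]

/-- The long-run throughput of the protocol. -/
noncomputable def throughput : ℝ :=
  Real.exp (-S.aBar) * Real.exp (-S.bBar) * min 1 (S.harvestRate / S.chargedLoss) / 2

theorem le_throughput :
    S.eta * S.Ps * Real.exp (-(S.aBar + S.bBar)) /
      (S.Pr * S.d1 ^ S.m * Real.exp (-S.aBar) + 2 * S.eta * S.Ps) ≤ S.throughput := by
  have hPs := S.Ps_pos
  have hPr := S.Pr_pos
  have hη := S.eta_pos
  have hT := S.T_pos
  have hd := Real.rpow_pos_of_pos S.d1_pos S.m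
  have ha := Real.exp_pos (-S.aBar)
  have hb := Real.exp_pos (-S.bBar)
  have hc := S.harvestRate_pos
  have hw := S.txEnergy_pos
  have hmin : S.harvestRate / (S.harvestRate + S.txEnergy * Real.exp (-S.aBar)) ≤
      min 1 (S.harvestRate / S.chargedLoss) := by
    refine le_min ?_ ?_
    · rw [div_le_one (by positivity)]
      have := mul_pos hw ha
      linarith
    · exact div_le_div_of_nonneg_left hc.le S.chargedLoss_pos S.chargedLoss_le
  have heq : S.eta * S.Ps * Real.exp (-(S.aBar + S.bBar)) /
      (S.Pr * S.d1 ^ S.m * Real.exp (-S.aBar) + 2 * S.eta * S.Ps) =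
      Real.exp (-S.aBar) * Real.exp (-S.bBar) *
        (S.harvestRate / (S.harvestRate + S.txEnergy * Real.exp (-S.aBar))) / 2 := by
    rw [neg_add, Real.exp_add]
    unfold harvestRate txEnergy
    field_simp
    ring
  rw [heq, throughput]
  gcongr

theorem blockThroughput_eq (e : ℝ) (h g : ℕ → ℂ) (i : ℕ) :
    S.blockThroughput e h g i =
      S.charged (S.energy e h i) * (S.relaySuccess (h i) * (1 - S.outage (g i))) / 2 := by
  rw [blockThroughput, one_sub_alpha]
  ring

theorem blockThroughput_mem_Icc (e : ℝ) (h g : ℕ → ℂ) (i : ℕ) :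
    S.blockThroughput e h g i ∈ Set.Icc (0 : ℝ) 1 := by
  rw [blockThroughput_eq]
  obtain ⟨h1, h1'⟩ := S.charged_mem_Icc (S.energy e h i)
  obtain ⟨h2, h2'⟩ := S.relaySuccess_mem_Icc (h i)
  obtain ⟨h3, h3'⟩ := S.one_sub_outage_mem_Icc (g i)
  have := mul_nonneg h1 (mul_nonneg h2 h3)
  have := mul_le_one₀ h1' (mul_nonneg h2 h3) (mul_le_one₀ h2' h3 h3')
  constructor <;> linarith

theorem measurable_gainSuccess :
    Measurable fun z : ℂ × ℂ => S.relaySuccess z.1 * (1 - S.outage z.2) :=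
  (S.measurable_relaySuccess.comp measurable_fst).mul
    (measurable_const.sub (S.measurable_outage.comp measurable_snd))

theorem gainSuccess_mem_Icc (z : ℂ × ℂ) :
    S.relaySuccess z.1 * (1 - S.outage z.2) ∈ Set.Icc (0 : ℝ) 1 :=
  ⟨mul_nonneg (S.relaySuccess_mem_Icc _).1 (S.one_sub_outage_mem_Icc _).1,
    mul_le_one₀ (S.relaySuccess_mem_Icc _).2 (S.one_sub_outage_mem_Icc _).1
      (S.one_sub_outage_mem_Icc _).2⟩

theorem integral_gainSuccess :
    ∫ z, S.relaySuccess z.1 * (1 - S.outage z.2) ∂(complexGaussian.prod complexGaussian) =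
      Real.exp (-S.aBar) * Real.exp (-S.bBar) := by
  rw [integral_prod_mul S.relaySuccess fun z => 1 - S.outage z, integral_relaySuccess,
    integral_one_sub_outage]

end RelaySystem

/-! ### Almost sure limits for the relay, and the conclusion. -/

section
variable {Ω : Type*} [MeasurableSpace Ω] {μ : Measure Ω} [IsProbabilityMeasure μ]

theorem map_prodMk_gains {h g : ℕ → Ω → ℂ}
    (h_meas : ∀ i, Measurable (h i)) (g_meas : ∀ i, Measurable (g i))
    (h_law : ∀ i, μ.map (h i) = complexGaussian) (g_law : ∀ i, μ.map (g i) = complexGaussian)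
    (hg_indep : iIndepFun (fun k : ℕ ⊕ ℕ => Sum.elim h g k) μ) (j : ℕ) :
    μ.map (fun ω => (h j ω, g j ω)) = complexGaussian.prod complexGaussian := by
  have h1 : IndepFun (h j) (g j) μ :=
    hg_indep.indepFun (i := Sum.inl j) (j := Sum.inr j) Sum.inl_ne_inr
  rw [(indepFun_iff_map_prod_eq_prod_map_map (h_meas j).aemeasurable (g_meas j).aemeasurable).1 h1,
    h_law, g_law]

/-- Almost surely, centred functions of the gains, weighted by the stored energy, average to zero. -/
theorem ae_tendsto_average_energy_mul (S : RelaySystem) {h g : ℕ → Ω → ℂ} {E₀ : Ω → ℝ}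
    (h_meas : ∀ i, Measurable (h i)) (g_meas : ∀ i, Measurable (g i)) (E₀_meas : Measurable E₀)
    (h_law : ∀ i, μ.map (h i) = complexGaussian) (g_law : ∀ i, μ.map (g i) = complexGaussian)
    (hg_indep : iIndepFun (fun k : ℕ ⊕ ℕ => Sum.elim h g k) μ)
    (E₀_indep : IndepFun E₀ (fun ω => ((fun i => h i ω), (fun i => g i ω))) μ)
    {H : ℝ → ℝ} (hH : Measurable H) (hH1 : ∀ e, |H e| ≤ 1) {f : ℂ × ℂ → ℝ} (hfm : Measurable f)
    (hf : MemLp f 2 (complexGaussian.prod complexGaussian)) :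
    ∀ᵐ ω ∂μ, Tendsto (fun N : ℕ => (∑ i ∈ Finset.range N,
      H (S.energy (E₀ ω) (fun j => h j ω) i) *
        (f (h i ω, g i ω) - ∫ z, f z ∂(complexGaussian.prod complexGaussian))) / N) atTop (𝓝 0) := by
  have hZ : ∀ k, Measurable fun ω => (h k ω, g k ω) := fun k => (h_meas k).prodMk (g_meas k)
  have hfst : Measurable fun b : ℝ × (ℕ → ℂ × ℂ) => (b.1, fun k => (b.2 k).1) := by fun_prop
  have key := ae_tendsto_average_zero_of_predictable (μ := μ)
    (past := pastOf E₀ fun i ω => (h i ω, g i ω)) (measurable_pastOf E₀_meas hZ) hZ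
    (map_prodMk_gains h_meas g_meas h_law g_law hg_indep)
    (indepFun_pastOf_prodMk h_meas g_meas E₀_meas hg_indep E₀_indep)
    (fun i j hij => exists_pastOf_eq _ _ hij)
    (H := fun j b => H (S.energy b.1 (fun k => (b.2 k).1) j))
    (fun j => hH.comp ((S.measurable_energy j).comp hfst)) (fun j b => hH1 _)
    (hfm.sub_const (∫ z, f z ∂(complexGaussian.prod complexGaussian))) (hf.sub (memLp_const _))
    (by rw [integral_sub (hf.integrable one_le_two) (integrable_const _)]; simp)
  filter_upwards [key] with ω hω
  refine hω.congr fun N => ?_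
  congr 1
  refine Finset.sum_congr rfl fun i _ => ?_
  have : S.energy (E₀ ω) (fun k => ((pastOf E₀ (fun i ω => (h i ω, g i ω)) i ω).2 k).1) i =
      S.energy (E₀ ω) (fun j => h j ω) i :=
    S.energy_congr _ i fun k hk => by simp [pastOf, hk]
  simp only [← this]
  rfl

end

theorem theorem4 (S : RelaySystem)
    {Ω : Type*} [MeasurableSpace Ω] (μ : Measure Ω) [IsProbabilityMeasure μ]
    (h g : ℕ → Ω → ℂ) (E₀ : Ω → ℝ)
    (h_meas : ∀ i, Measurable (h i)) (g_meas : ∀ i, Measurable (g i)) (E₀_meas : Measurable E₀)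
    (h_law : ∀ i, μ.map (h i) = complexGaussian)
    (g_law : ∀ i, μ.map (g i) = complexGaussian)
    (hg_indep : iIndepFun (fun k : ℕ ⊕ ℕ => Sum.elim h g k) μ)
    (E₀_nonneg : ∀ ω, 0 ≤ E₀ ω)
    (E₀_indep : IndepFun E₀ (fun ω => ((fun i => h i ω), (fun i => g i ω))) μ) :
    ∃ τ : ℝ,
      IsThroughput μ
        (fun i ω => S.blockThroughput (E₀ ω) (fun j => h j ω) (fun j => g j ω) i) τ ∧
      ((∀ i, μ.map (fun ω => S.energy (E₀ ω) (fun j => h j ω) i) = μ.map E₀) →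
        ∀ i, ∫ ω, S.blockThroughput (E₀ ω) (fun j => h j ω) (fun j => g j ω) i ∂μ = τ) ∧
      S.eta * S.Ps * Real.exp (-(S.aBar + S.bBar)) /
          (S.Pr * S.d1 ^ S.m * Real.exp (-S.aBar) + 2 * S.eta * S.Ps) ≤ τ := by
  have hZ : ∀ k, Measurable fun ω => (h k ω, g k ω) := fun k => (h_meas k).prodMk (g_meas k)
  have hEm : ∀ i, Measurable fun ω => S.energy (E₀ ω) (fun j => h j ω) i := fun i =>
    (S.measurable_energy i).comp (E₀_meas.prodMk (measurable_pi_iff.2 h_meas))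
  have hcm := S.measurable_charged
  have htm : ∀ i, Measurable fun ω =>
      S.blockThroughput (E₀ ω) (fun j => h j ω) (fun j => g j ω) i := fun i => by
    simp_rw [RelaySystem.blockThroughput_eq]
    exact ((hcm.comp (hEm i)).mul (S.measurable_gainSuccess.comp (hZ i))).div_const 2
  have hti : ∀ i, Integrable (fun ω =>
      S.blockThroughput (E₀ ω) (fun j => h j ω) (fun j => g j ω) i) μ := fun i =>
    (RelaySystem.memLp_two_of_mem_Icc (htm i)
      fun ω => S.blockThroughput_mem_Icc _ _ _ i).integrable one_le_two
  have hch1 : ∀ e, |S.charged e| ≤ 1 := fun e => by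
    rw [abs_of_nonneg (S.charged_mem_Icc e).1]
    exact (S.charged_mem_Icc e).2
  have hfst : ∀ f : ℂ → ℝ, ∫ z, f z.1 ∂(complexGaussian.prod complexGaussian) =
      ∫ z, f z ∂complexGaussian := fun f => by
    rw [integral_fun_fst]
    simp
  -- Three averages are needed: `hharvest` and `hloss` together form the noise in the energy
  -- recursion, while `hsucc` replaces the success indicators in charged blocks by their
  -- probability.
  have hharvest := ae_tendsto_average_energy_mul S h_meas g_meas E₀_meas h_law g_law hg_indep
    E₀_indep (H := fun _ => 1) measurable_const (by simp)
    (f := fun z => S.harvestRate * ‖z.1‖ ^ 2) (by fun_prop)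
    ((memLp_norm_sq_complexGaussian.const_mul S.harvestRate).comp_fst complexGaussian)
  have hloss := ae_tendsto_average_energy_mul S h_meas g_meas E₀_meas h_law g_law hg_indep
    E₀_indep hcm hch1
    (f := fun z => (S.harvestRate * ‖z.1‖ ^ 2 + S.txEnergy) * S.relaySuccess z.1)
    (Measurable.mul (by fun_prop) (S.measurable_relaySuccess.comp measurable_fst))
    (S.memLp_loss.comp_fst complexGaussian)
  have hsucc := ae_tendsto_average_energy_mul S h_meas g_meas E₀_meas h_law g_law hg_indep
    E₀_indep hcm hch1 S.measurable_gainSuccess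
    (RelaySystem.memLp_two_of_mem_Icc S.measurable_gainSuccess S.gainSuccess_mem_Icc)
  rw [hfst fun z => S.harvestRate * ‖z‖ ^ 2, integral_const_mul,
    integral_norm_sq_complexGaussian, mul_one] at hharvest
  rw [hfst fun z => (S.harvestRate * ‖z‖ ^ 2 + S.txEnergy) * S.relaySuccess z] at hloss
  rw [S.integral_gainSuccess] at hsucc
  have hae : ∀ᵐ ω ∂μ, Tendsto (fun N : ℕ => (∑ i ∈ Finset.range N,
      S.blockThroughput (E₀ ω) (fun j => h j ω) (fun j => g j ω) i) / (N : ℝ)) atTop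
      (𝓝 S.throughput) := by
    filter_upwards [hharvest, hloss, hsucc] with ω h1 h2 h3
    have hM := h1.sub h2
    rw [sub_zero] at hM
    have hfrac := tendsto_fraction_above_level (E := S.energy (E₀ ω) fun j => h j ω)
      (M := fun N => ∑ i ∈ Finset.range N, (S.harvestRate * (‖h i ω‖ ^ 2 - 1) -
        S.charged (S.energy (E₀ ω) (fun j => h j ω) i) *
          ((S.harvestRate * ‖h i ω‖ ^ 2 + S.txEnergy) * S.relaySuccess (h i ω) - S.chargedLoss)))
      (w := S.txEnergy) (c := S.harvestRate) (D := S.harvestRate - S.chargedLoss)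
      (S.energy_nonneg (E₀_nonneg ω) _) ?_ S.harvestRate_pos (by linarith [S.chargedLoss_pos])
      fun n => ?_
    · rw [sub_sub_cancel] at hfrac
      have hlim := (h3.add (hfrac.const_mul (Real.exp (-S.aBar) * Real.exp (-S.bBar)))).div_const 2
      rw [zero_add] at hlim
      refine hlim.congr fun N => ?_
      rw [← mul_div_assoc, ← add_div, Finset.mul_sum, ← Finset.sum_add_distrib, div_right_comm,
        Finset.sum_div]
      congr 1
      refine Finset.sum_congr rfl fun i _ => ?_
      rw [S.blockThroughput_eq, ← RelaySystem.charged]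
      ring
    · refine hM.congr fun N => ?_
      rw [← sub_div, ← Finset.sum_sub_distrib]
      congr 1
      refine Finset.sum_congr rfl fun i _ => ?_
      simp only [RelaySystem.chargedLoss]
      ring
    · rw [Finset.sum_range_succ, add_sub_cancel_left]
      exact S.energyAfter_eq _ _
  have hmean : Tendsto (fun N : ℕ => (∑ i ∈ Finset.range N,
      ∫ ω, S.blockThroughput (E₀ ω) (fun j => h j ω) (fun j => g j ω) i ∂μ) / (N : ℝ)) atTop
      (𝓝 S.throughput) := by
    -- Block throughputs lie in `[0, 1]`, so the almost sure limit passes to expectations.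
    have hdom := tendsto_integral_of_dominated_convergence (μ := μ) (fun _ => (1 : ℝ))
      (fun N => ((Finset.measurable_sum (Finset.range N) fun i _ => htm i).div_const
        (N : ℝ)).aestronglyMeasurable) (integrable_const _)
      (fun N => Eventually.of_forall fun ω => ?_) hae
    · rw [integral_const, probReal_univ, one_smul] at hdom
      refine hdom.congr fun N => ?_
      rw [integral_div, integral_finsetSum _ fun i _ => hti i]
    · rw [Real.norm_of_nonneg (div_nonneg (Finset.sum_nonneg fun i _ =>
        (S.blockThroughput_mem_Icc _ _ _ i).1) N.cast_nonneg)]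
      refine div_le_one_of_le₀ ?_ N.cast_nonneg
      have := Finset.sum_le_card_nsmul (Finset.range N)
        (fun i => S.blockThroughput (E₀ ω) (fun j => h j ω) (fun j => g j ω) i) 1
        fun i _ => (S.blockThroughput_mem_Icc _ _ _ i).2
      simpa using this
  refine ⟨S.throughput, ⟨hti, hae, hmean⟩, fun hstat => ?_, S.le_throughput⟩
  -- The energy at block `i` is independent of the gains at `i`, so the mean factors; under
  -- stationarity the value does not depend on `i`, and the limit of its time averages must be that
  -- value.
  have hconst : ∀ i, ∫ ω, S.blockThroughput (E₀ ω) (fun j => h j ω) (fun j => g j ω) i ∂μ =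
      (∫ e, S.charged e ∂(μ.map E₀)) * (Real.exp (-S.aBar) * Real.exp (-S.bBar)) / 2 := by
    intro i
    have hind : IndepFun (fun ω => S.charged (S.energy (E₀ ω) (fun j => h j ω) i))
        (fun ω => S.relaySuccess (h i ω) * (1 - S.outage (g i ω))) μ := by
      have hfst' : Measurable fun b : ℝ × (ℕ → ℂ × ℂ) => (b.1, fun k => (b.2 k).1) := by fun_prop
      have := (indepFun_pastOf_prodMk h_meas g_meas E₀_meas hg_indep E₀_indep i).comp
        (hcm.comp ((S.measurable_energy i).comp hfst')) S.measurable_gainSuccess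
      convert! this using 1
      funext ω
      exact congrArg S.charged (S.energy_congr _ i fun k hk => by simp [pastOf, hk])
    simp_rw [RelaySystem.blockThroughput_eq]
    rw [integral_div, hind.integral_fun_mul_eq_mul_integral
      (hcm.comp (hEm i)).aestronglyMeasurable
      (S.measurable_gainSuccess.comp (hZ i)).aestronglyMeasurable, ← hstat i,
      integral_map (hEm i).aemeasurable hcm.aestronglyMeasurable, ← S.integral_gainSuccess,
      ← map_prodMk_gains h_meas g_meas h_law g_law hg_indep i,
      integral_map (hZ i).aemeasurable S.measurable_gainSuccess.aestronglyMeasurable]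
  intro i
  rw [hconst i]
  refine tendsto_nhds_unique (Tendsto.congr' ?_ tendsto_const_nhds) hmean
  filter_upwards [eventually_gt_atTop 0] with N hN
  have hN' : (N : ℝ) ≠ 0 := by exact_mod_cast hN.ne'
  simp_rw [hconst]
  rw [Finset.sum_const, Finset.card_range, nsmul_eq_mul, mul_div_cancel_left₀ _ hN']
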